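/- A convex body in $\mathbb{R}^n$ ($n\ge 1$) is a compact convex set with nonempty interior, and $|\cdot|$ denotes both Lebesgue measure and the Euclidean norm. A convex body $K$ is isotropic with constant $L>0$ if its centroid is $0$, $|K|=1$, and $\int_K \langle x,y\rangle^2\,dx = L^2|y|^2$ for all $y\in\mathbb{R}^n$. For a convex body $K$, the isotropic constant $L_K$ is the number $L$ such that some affine image $T(K)$ of $K$ under an invertible affine map $T$ is isotropic with constant $L$. For convex bodies $B,K\subset\mathbb{R}^n$, the volume ratio of $K$ in $B$ is $$\mathrm{vr}(B,K)=\min_T\left(\frac{|B|}{|T(K)|}\right)^{1/n},$$ where $T$ runs over the invertible affine transformations of $\mathbb{R}^n$ with $T(K)\subset B$. Let $D_n$ be the Euclidean ball in $\mathbb{R}^n$ centred at the origin with $|D_n|=1$. **Corollary.** For every real $c$ there is a constant $c'$, depending only on $c$, such that for every $n\ge 1$ and every convex body $K\subset\mathbb{R}^n$ with $\mathrm{vr}(D_n,K)\le c$, the isotropic constant $L_K$ is well defined (exactly one such $L$ exists) and $L_K\le c'$. -/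

import Mathlib

open MeasureTheory
open scoped ENNReal

/-- The closed Euclidean ball in `ℝⁿ` centred at the origin with volume one (for `n ≥ 1`): its radius
is `|B|^(-1/n)`, where `B` is the closed unit ball. -/
noncomputable def volumeOneBall (n : ℕ) : Set (EuclideanSpace ℝ (Fin n)) :=
  Metric.closedBall 0
    ((volume (Metric.closedBall (0 : EuclideanSpace ℝ (Fin n)) 1)).toReal ^ (-(1 / (n : ℝ))))

theorem volume_volumeOneBall {n : ℕ} (hn : 1 ≤ n) : volume (volumeOneBall n) = 1 := by
  have : Nonempty (Fin n) := ⟨⟨0, hn⟩⟩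
  set B := Metric.closedBall (0 : EuclideanSpace ℝ (Fin n)) 1 with hB
  have hpos : 0 < volume B := Metric.measure_closedBall_pos _ _ one_pos
  have hfin : volume B ≠ ∞ := (isCompact_closedBall _ _).measure_lt_top.ne
  have hr : 0 < (volume B).toReal := ENNReal.toReal_pos hpos.ne' hfin
  have hn0 : (n : ℝ) ≠ 0 := by positivity
  have hpow : ((volume B).toReal ^ (-(1 / (n : ℝ)))) ^ n = (volume B).toReal⁻¹ := by
    rw [← Real.rpow_natCast, ← Real.rpow_mul hr.le]
    rw [show -(1 / (n : ℝ)) * (n : ℝ) = -1 by field_simp, Real.rpow_neg_one]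
  unfold volumeOneBall
  rw [Measure.addHaar_closedBall' _ _ (by positivity), finrank_euclideanSpace_fin, ← hB, hpow,
    ENNReal.ofReal_inv_of_pos hr, ENNReal.ofReal_toReal hfin,
    ENNReal.inv_mul_cancel hpos.ne' hfin]

/-- The volume ratio `vr(B, K)` of `K` in `B`: the infimum of `(|B| / |T(K)|)^(1/n)` over the
(invertible) affine transformations `T` of `ℝⁿ` with `T(K) ⊆ B`, as an extended nonnegative
number. (For convex bodies with nonempty interior the infimum is finite and attained.) -/
noncomputable def volumeRatio {n : ℕ} (B K : Set (EuclideanSpace ℝ (Fin n))) : ℝ≥0∞ :=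
  ⨅ (T : EuclideanSpace ℝ (Fin n) ≃ᵃ[ℝ] EuclideanSpace ℝ (Fin n)) (_ : T '' K ⊆ B),
    (volume B / volume (T '' K)) ^ (1 / (n : ℝ))

/-- `K` is isotropic with constant `L`: its centroid is `0`, its volume is `1`, and
`∫_K ⟨x, y⟩² dx = L² |y|²` for all `y`, with `L > 0`. -/
structure IsIsotropicWith {n : ℕ} (K : Set (EuclideanSpace ℝ (Fin n))) (L : ℝ) : Prop where
  centroid : ∫ x in K, x = 0
  volume_eq_one : volume K = 1
  pos : 0 < L
  second_moment : ∀ y : EuclideanSpace ℝ (Fin n),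
    ∫ x in K, (inner ℝ x y) ^ 2 = L ^ 2 * ‖y‖ ^ 2

/-- `L` is the isotropic constant `L_K` of `K`: some affine image `T(K)` of `K` is isotropic
with constant `L`. -/
def IsIsotropicConstantOf {n : ℕ} (K : Set (EuclideanSpace ℝ (Fin n))) (L : ℝ) : Prop :=
  ∃ T : EuclideanSpace ℝ (Fin n) ≃ᵃ[ℝ] EuclideanSpace ℝ (Fin n), IsIsotropicWith (T '' K) L

/-! The isotropic position minimises the second moment among affine images of given volume. If `K`
is isotropic with constant `L` and `T` has linear part `A`, then `∫_K |Tx|² ≥ L² ‖A‖²_HS ≥ n L² |det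
A|^(2/n)`; the second inequality is AM-GM (`card_mul_rpow_det_le_sum_sq`), and together they are
`IsIsotropicWith.card_mul_le_setIntegral_norm_sq`. If `T(K) ⊆ D_n`, the integral is at most `n`,
since `D_n` has radius at most `√n`. Hence `L ≤ |T(K)|^(-1/n)`, and so `L_K ≤ vr(D_n, K)`. Applied
between two isotropic images, the same inequality gives uniqueness of `L_K`. Existence comes from
normalising the positive definite covariance form. -/

/-! ### The determinant inequality and the radius of `D_n`. -/

open Matrix in
theorem card_mul_rpow_det_le_sum_sq {n : ℕ} (hn : 1 ≤ n) (A : Matrix (Fin n) (Fin n) ℝ) :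
    (n : ℝ) * (|A.det| ^ (1 / (n : ℝ))) ^ 2 ≤ ∑ i, ∑ j, A i j ^ 2 := by
  have hn0 : (0 : ℝ) < n := by exact_mod_cast hn
  have hP : (Aᴴ * A).PosSemidef := posSemidef_conjTranspose_mul_self A
  have htr : (Aᴴ * A).trace = ∑ i, ∑ j, A i j ^ 2 := by
    rw [Finset.sum_comm]
    simp [Matrix.trace, Matrix.mul_apply, sq]
  have hdet : (Aᴴ * A).det = |A.det| ^ 2 := by
    simp [Matrix.det_mul, sq]
  rw [hP.isHermitian.trace_eq_sum_eigenvalues] at htr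
  rw [hP.isHermitian.det_eq_prod_eigenvalues] at hdet
  simp only [RCLike.ofReal_real_eq_id, id] at htr hdet
  -- AM-GM for the eigenvalues of `AᴴA`: their product is `|det A|²`, their sum `‖A‖²_HS`.
  have h := Real.geom_mean_le_arith_mean Finset.univ (fun _ => (1 : ℝ)) hP.isHermitian.eigenvalues
    (fun _ _ => zero_le_one) (by simpa using hn0) (fun i _ => hP.eigenvalues_nonneg i)
  simp only [Real.rpow_one, Finset.sum_const, Finset.card_univ, Fintype.card_fin, nsmul_eq_mul,
    mul_one, one_mul, hdet, htr] at h
  rw [le_div_iff₀ hn0, mul_comm] at h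
  refine le_trans (le_of_eq ?_) h
  rw [← Real.rpow_natCast, ← Real.rpow_natCast, ← Real.rpow_mul (abs_nonneg _),
    ← Real.rpow_mul (abs_nonneg _), mul_comm (1 / (n : ℝ)), one_div]

/-- The ball of radius `√n` contains the unit cube `[0,1]ⁿ`, which has volume one. -/
theorem one_le_volume_closedBall_mul_pow (n : ℕ) :
    1 ≤ (volume (Metric.closedBall (0 : EuclideanSpace ℝ (Fin n)) 1)).toReal * √n ^ n := by
  have hfin : volume (Metric.closedBall (0 : EuclideanSpace ℝ (Fin n)) √n) ≠ ∞ :=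
    (isCompact_closedBall _ _).measure_lt_top.ne
  have hcube : (1 : ℝ≥0∞) ≤ volume (Metric.closedBall (0 : EuclideanSpace ℝ (Fin n)) √n) := by
    rw [← (PiLp.volume_preserving_toLp (Fin n)).measure_preimage
      Metric.isClosed_closedBall.measurableSet.nullMeasurableSet]
    have : volume (Set.Icc (0 : Fin n → ℝ) 1) = 1 := by simp [Real.volume_Icc_pi]
    rw [← this]
    refine measure_mono fun x hx => ?_
    simp only [Set.mem_preimage, mem_closedBall_zero_iff, EuclideanSpace.norm_eq]
    refine Real.sqrt_le_sqrt ?_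
    calc ∑ i, ‖x i‖ ^ 2 ≤ ∑ _i : Fin n, (1 : ℝ) := Finset.sum_le_sum fun i _ => by
            have h0 := hx.1 i
            have h1 := hx.2 i
            simp only [Pi.zero_apply, Pi.one_apply] at h0 h1
            rw [Real.norm_eq_abs, sq_abs]
            nlinarith
      _ = n := by simp
  rw [← ENNReal.ofReal_one, ENNReal.ofReal_le_iff_le_toReal hfin,
    Measure.addHaar_closedBall' _ _ (Real.sqrt_nonneg _), finrank_euclideanSpace_fin,
    ENNReal.toReal_mul, ENNReal.toReal_ofReal (by positivity)] at hcube
  linarith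

theorem volumeOneBall_subset_closedBall_sqrt {n : ℕ} (hn : 1 ≤ n) :
    volumeOneBall n ⊆ Metric.closedBall 0 √n := by
  refine Metric.closedBall_subset_closedBall ?_
  have hn0 : (n : ℝ) ≠ 0 := by positivity
  have h := one_le_volume_closedBall_mul_pow n
  set v := (volume (Metric.closedBall (0 : EuclideanSpace ℝ (Fin n)) 1)).toReal
  have hv0 : 0 ≤ v := ENNReal.toReal_nonneg
  have hv : 0 < v := lt_of_le_of_ne hv0 fun h0 => by rw [← h0] at h; norm_num at h
  rw [Real.rpow_neg hv0]
  have h1 : v⁻¹ ≤ √n ^ n := by rw [inv_le_iff_one_le_mul₀ hv]; linarith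
  calc (v ^ (1 / (n : ℝ)))⁻¹ = v⁻¹ ^ (1 / (n : ℝ)) := (Real.inv_rpow hv0 _).symm
    _ ≤ (√n ^ n) ^ (1 / (n : ℝ)) := by gcongr
    _ = √n := by
      rw [← Real.rpow_natCast, ← Real.rpow_mul (Real.sqrt_nonneg _), mul_one_div_cancel hn0,
        Real.rpow_one]

/-! ### Affine images, second moments and uniqueness. -/

theorem volume_image_affineEquiv {n : ℕ}
    (T : EuclideanSpace ℝ (Fin n) ≃ᵃ[ℝ] EuclideanSpace ℝ (Fin n))
    (s : Set (EuclideanSpace ℝ (Fin n))) :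
    volume (T '' s) = ENNReal.ofReal |LinearMap.det (T.linear : EuclideanSpace ℝ (Fin n) →ₗ[ℝ] _)| * volume s := by
  have : T '' s = (fun x => T 0 + x) '' ((T.linear : EuclideanSpace ℝ (Fin n) →ₗ[ℝ] _) '' s) := by
    rw [Set.image_image]
    refine Set.image_congr fun x _ => ?_
    have := T.map_vadd 0 x
    simpa [add_comm] using this
  rw [this, Set.image_add_left, measure_preimage_add, Measure.addHaar_image_linearMap]

theorem setIntegral_image_affineEquiv {n : ℕ} {F : Type*} [NormedAddCommGroup F] [NormedSpace ℝ F]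
    (T : EuclideanSpace ℝ (Fin n) ≃ᵃ[ℝ] EuclideanSpace ℝ (Fin n))
    {s : Set (EuclideanSpace ℝ (Fin n))} (hs : MeasurableSet s)
    (f : EuclideanSpace ℝ (Fin n) → F) :
    ∫ x in T '' s, f x = |LinearMap.det (T.linear : EuclideanSpace ℝ (Fin n) →ₗ[ℝ] _)| • ∫ x in s, f (T x) := by
  have hd : ∀ x ∈ s, HasFDerivWithinAt T
      (LinearMap.toContinuousLinearMap (T.linear : EuclideanSpace ℝ (Fin n) →ₗ[ℝ] _)) s x := fun x _ => by
    have : (T : EuclideanSpace ℝ (Fin n) → EuclideanSpace ℝ (Fin n)) =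
        fun x => LinearMap.toContinuousLinearMap (T.linear : EuclideanSpace ℝ (Fin n) →ₗ[ℝ] _) x + T 0 := by
      funext x
      have := T.map_vadd 0 x
      simpa using this
    rw [this]
    exact (ContinuousLinearMap.hasFDerivWithinAt _).add_const _
  rw [integral_image_eq_integral_abs_det_fderiv_smul volume hs hd T.injective.injOn]
  simp only [LinearMap.det_toContinuousLinearMap]
  rw [integral_smul]

/-- Each row `u i` of the linear part contributes `L² ‖u i‖²`. The centroid is `0`, so the cross
term with the translation vanishes, and the translation can only increase the integral. -/
theorem IsIsotropicWith.card_mul_le_setIntegral_norm_sq {n : ℕ} (hn : 1 ≤ n)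
    {K : Set (EuclideanSpace ℝ (Fin n))} (hK : IsCompact K) {L : ℝ} (h : IsIsotropicWith K L)
    (T : EuclideanSpace ℝ (Fin n) ≃ᵃ[ℝ] EuclideanSpace ℝ (Fin n)) :
    n * ((|LinearMap.det (T.linear : EuclideanSpace ℝ (Fin n) →ₗ[ℝ] _)| ^ (1 / (n : ℝ))) * L) ^ 2 ≤
      ∫ x in K, ‖T x‖ ^ 2 := by
  obtain ⟨A, hA⟩ := (Matrix.toEuclideanLin (𝕜 := ℝ) (m := Fin n) (n := Fin n)).surjective
    (T.linear : EuclideanSpace ℝ (Fin n) →ₗ[ℝ] _)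
  have hdet : LinearMap.det (T.linear : EuclideanSpace ℝ (Fin n) →ₗ[ℝ] _) = A.det := by
    rw [← hA, LinearMap.det_toLpLin]
  set b := T 0
  set u : Fin n → EuclideanSpace ℝ (Fin n) := fun i => WithLp.toLp 2 (A i)
  have hT : ∀ x i, T x i = inner ℝ x (u i) + b i := fun x i => by
    have h1 := T.map_vadd 0 x
    have h2 : T x = T.linear x + b := by simpa using h1
    have h3 : T.linear x = Matrix.toEuclideanLin A x := by rw [hA]; rfl
    rw [h2, h3]
    simp [u, PiLp.inner_apply, Matrix.mulVec, dotProduct]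
  have hint : ∀ {f : EuclideanSpace ℝ (Fin n) → ℝ}, Continuous f → IntegrableOn f K :=
    fun hf => hf.continuousOn.integrableOn_compact hK
  have hcoord : ∀ i, L ^ 2 * ‖u i‖ ^ 2 ≤ ∫ x in K, (T x i) ^ 2 := fun i => by
    have h0 : ∫ x in K, inner ℝ x (u i) = 0 := by
      simp_rw [real_inner_comm (u i)]
      have hid : IntegrableOn (fun x : EuclideanSpace ℝ (Fin n) => x) K :=
        continuous_id.continuousOn.integrableOn_compact hK
      rw [integral_inner hid, h.centroid, inner_zero_right]
    simp_rw [hT, add_sq]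
    rw [integral_add (hint (by fun_prop)) (hint (by fun_prop)),
      integral_add (hint (by fun_prop)) (hint (by fun_prop)), integral_mul_const,
      integral_const_mul, h0, h.second_moment]
    simp only [mul_zero, zero_mul, add_zero]
    refine le_add_of_nonneg_right (integral_nonneg fun _ => sq_nonneg _)
  have hTc : Continuous T := T.toAffineMap.continuous_of_finiteDimensional
  calc _ = L ^ 2 * (n * (|A.det| ^ (1 / (n : ℝ))) ^ 2) := by rw [hdet]; ring
    _ ≤ L ^ 2 * ∑ i, ∑ j, A i j ^ 2 := by gcongr; exact card_mul_rpow_det_le_sum_sq hn A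
    _ = ∑ i, L ^ 2 * ‖u i‖ ^ 2 := by
      rw [Finset.mul_sum]
      simp [u, EuclideanSpace.norm_sq_eq]
    _ ≤ ∑ i, ∫ x in K, (T x i) ^ 2 := Finset.sum_le_sum fun i _ => hcoord i
    _ = ∫ x in K, ‖T x‖ ^ 2 := by
      rw [← integral_finsetSum _ fun i _ => hint (by fun_prop)]
      simp [EuclideanSpace.norm_sq_eq]

theorem IsIsotropicWith.setIntegral_norm_sq {n : ℕ} {K : Set (EuclideanSpace ℝ (Fin n))}
    (hK : IsCompact K) {L : ℝ} (h : IsIsotropicWith K L) :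
    ∫ x in K, ‖x‖ ^ 2 = n * L ^ 2 := by
  have hcoord : ∀ i, ∫ x in K, (x i) ^ 2 = L ^ 2 := fun i => by
    have := h.second_moment (EuclideanSpace.single i 1)
    simpa [EuclideanSpace.inner_single_right] using this
  simp_rw [EuclideanSpace.norm_sq_eq, Real.norm_eq_abs, sq_abs]
  rw [integral_finsetSum _ fun i _ =>
    (by fun_prop : Continuous fun x : EuclideanSpace ℝ (Fin n) =>
      x i ^ 2).continuousOn.integrableOn_compact hK]
  simp [hcoord]

theorem IsCompact.image_affineEquiv {n : ℕ} {K : Set (EuclideanSpace ℝ (Fin n))} (hK : IsCompact K)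
    (T : EuclideanSpace ℝ (Fin n) ≃ᵃ[ℝ] EuclideanSpace ℝ (Fin n)) : IsCompact (T '' K) :=
  hK.image T.toAffineMap.continuous_of_finiteDimensional

theorem image_symm_trans_image {n : ℕ}
    (S T : EuclideanSpace ℝ (Fin n) ≃ᵃ[ℝ] EuclideanSpace ℝ (Fin n))
    (K : Set (EuclideanSpace ℝ (Fin n))) : (S.symm.trans T) '' (S '' K) = T '' K := by
  rw [Set.image_image]
  simp

theorem abs_det_linear_eq_toReal_volume_image {n : ℕ}
    (T : EuclideanSpace ℝ (Fin n) ≃ᵃ[ℝ] EuclideanSpace ℝ (Fin n))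
    {K : Set (EuclideanSpace ℝ (Fin n))} (hK : volume K = 1) :
    |LinearMap.det (T.linear : EuclideanSpace ℝ (Fin n) →ₗ[ℝ] _)| = (volume (T '' K)).toReal := by
  rw [volume_image_affineEquiv, hK, mul_one, ENNReal.toReal_ofReal (abs_nonneg _)]

/-- The map between the two images preserves volume, so the second-moment inequality reads `n L² ≤ n
M²`. -/
theorem IsIsotropicWith.le_of_image_affineEquiv {n : ℕ} (hn : 1 ≤ n)
    {K : Set (EuclideanSpace ℝ (Fin n))} (hK : IsCompact K)
    {S T : EuclideanSpace ℝ (Fin n) ≃ᵃ[ℝ] EuclideanSpace ℝ (Fin n)} {L M : ℝ}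
    (hS : IsIsotropicWith (S '' K) L) (hT : IsIsotropicWith (T '' K) M) : L ≤ M := by
  have hn0 : (0 : ℝ) < n := by exact_mod_cast hn
  have hSK := hK.image_affineEquiv S
  have hdet := abs_det_linear_eq_toReal_volume_image (S.symm.trans T) hS.volume_eq_one
  have hint := setIntegral_image_affineEquiv (S.symm.trans T) hSK.measurableSet fun x => ‖x‖ ^ 2
  have h := hS.card_mul_le_setIntegral_norm_sq hn hSK (S.symm.trans T)
  rw [image_symm_trans_image, hT.volume_eq_one, ENNReal.toReal_one] at hdet
  rw [image_symm_trans_image, hdet, hT.setIntegral_norm_sq (hK.image_affineEquiv T), one_smul] at hint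
  rw [← hint, hdet, Real.one_rpow, one_mul] at h
  exact le_of_sq_le_sq (le_of_mul_le_mul_left h hn0) hT.pos.le

/-! ### Existence of an isotropic image. -/

theorem setIntegral_inner_sub_sq_pos {n : ℕ} {K : Set (EuclideanSpace ℝ (Fin n))}
    (hK : IsCompact K) (hKi : (interior K).Nonempty) (g : EuclideanSpace ℝ (Fin n))
    {y : EuclideanSpace ℝ (Fin n)} (hy : y ≠ 0) : 0 < ∫ x in K, (inner ℝ (x - g) y) ^ 2 := by
  have hc : Continuous fun x : EuclideanSpace ℝ (Fin n) => (inner ℝ (x - g) y) ^ 2 := by fun_prop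
  rw [setIntegral_pos_iff_support_of_nonneg_ae (.of_forall fun _ => sq_nonneg _)
    (hc.continuousOn.integrableOn_compact hK)]
  have ho : IsOpen (Function.support (fun x : EuclideanSpace ℝ (Fin n) => (inner ℝ (x - g) y) ^ 2) ∩
      interior K) := (hc.isOpen_support).inter isOpen_interior
  refine (ho.measure_pos volume ?_).trans_le (measure_mono (by gcongr; exact interior_subset))
  obtain ⟨a, ha⟩ := hKi
  -- If the interior point lies on the hyperplane where the form vanishes, a small shift along `y`
  -- leaves it.
  by_cases h0 : inner ℝ (a - g) y = 0
  · have ht : Filter.Tendsto (fun t : ℝ => a + t • y) (nhdsWithin 0 {0}ᶜ) (nhds a) := by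
      have : Continuous fun t : ℝ => a + t • y := by fun_prop
      simpa using (this.tendsto 0).mono_left nhdsWithin_le_nhds
    obtain ⟨t, ht1, ht2⟩ := ((ht.eventually (isOpen_interior.mem_nhds ha)).and
      self_mem_nhdsWithin).exists
    refine ⟨a + t • y, ?_, ht1⟩
    have : inner ℝ (a + t • y - g) y = t * ‖y‖ ^ 2 := by
      rw [add_sub_right_comm, inner_add_left, h0, inner_smul_left, real_inner_self_eq_norm_sq]
      simp
    simp only [Function.mem_support, this]
    have : ‖y‖ ≠ 0 := norm_ne_zero_iff.2 hy
    have : t ≠ 0 := ht2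
    positivity
  · exact ⟨a, pow_ne_zero 2 h0, ha⟩

open Matrix in
/-- The covariance form of a convex body about any point is `‖B y‖²` for an invertible matrix `B`. -/
theorem exists_matrix_setIntegral_inner_sub_sq {n : ℕ} {K : Set (EuclideanSpace ℝ (Fin n))}
    (hK : IsCompact K) (hKi : (interior K).Nonempty) (g : EuclideanSpace ℝ (Fin n)) :
    ∃ B : Matrix (Fin n) (Fin n) ℝ, IsUnit B.det ∧ ∀ y : EuclideanSpace ℝ (Fin n),
      ∫ x in K, (inner ℝ (x - g) y) ^ 2 = ‖Matrix.toEuclideanLin B y‖ ^ 2 := by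
  set C : Matrix (Fin n) (Fin n) ℝ := Matrix.of fun i j => ∫ x in K, (x - g) i * (x - g) j with hC
  have hform : ∀ y : EuclideanSpace ℝ (Fin n),
      ∫ x in K, (inner ℝ (x - g) y) ^ 2 = y.ofLp ⬝ᵥ (C *ᵥ y.ofLp) := fun y => by
    have hi : ∀ i j, IntegrableOn (fun x : EuclideanSpace ℝ (Fin n) =>
        y i * ((x - g) i * (x - g) j * y j)) K := fun i j =>
      (by fun_prop : Continuous fun x : EuclideanSpace ℝ (Fin n) =>
        y i * ((x - g) i * (x - g) j * y j)).continuousOn.integrableOn_compact hK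
    have hx : ∀ x : EuclideanSpace ℝ (Fin n), (inner ℝ (x - g) y) ^ 2 =
        ∑ i, ∑ j, y i * ((x - g) i * (x - g) j * y j) := fun x => by
      rw [PiLp.inner_apply, sq, Finset.sum_mul_sum]
      refine Finset.sum_congr rfl fun i _ => Finset.sum_congr rfl fun j _ => ?_
      simp only [RCLike.inner_apply, conj_trivial]
      ring
    simp_rw [hx]
    rw [integral_finsetSum _ fun i _ => integrable_finsetSum _ fun j _ => hi i j]
    simp only [dotProduct, mulVec, hC, Matrix.of_apply, Finset.mul_sum]
    refine Finset.sum_congr rfl fun i _ => ?_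
    rw [integral_finsetSum _ fun j _ => hi i j]
    refine Finset.sum_congr rfl fun j _ => ?_
    rw [integral_const_mul, integral_mul_const]
  have hpos : C.PosDef := by
    refine .of_dotProduct_mulVec_pos ?_ fun y hy => ?_
    · ext i j
      simp only [hC, conjTranspose_apply, Matrix.of_apply, star_trivial]
      simp_rw [mul_comm]
    · rw [star_trivial, ← WithLp.ofLp_toLp 2 y, ← hform]
      exact setIntegral_inner_sub_sq_pos hK hKi g (by simpa using hy)
  obtain ⟨B, hB⟩ : ∃ B : Matrix (Fin n) (Fin n) ℝ, C = Bᴴ * B := by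
    open scoped MatrixOrder in
    exact CStarAlgebra.nonneg_iff_eq_star_mul_self.mp hpos.posSemidef.nonneg
  refine ⟨B, ?_, fun y => ?_⟩
  · have := hpos.det_pos
    rw [hB, det_mul] at this
    exact isUnit_iff_ne_zero.2 fun h => by simp [h] at this
  · rw [hform, hB, ← real_inner_self_eq_norm_sq, EuclideanSpace.inner_eq_star_dotProduct,
      ← mulVec_mulVec, dotProduct_mulVec, vecMul_conjTranspose]
    simp

theorem exists_isIsotropicConstantOf {n : ℕ} (hn : 1 ≤ n) {K : Set (EuclideanSpace ℝ (Fin n))}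
    (hK : IsCompact K) (hKi : (interior K).Nonempty) : ∃ L : ℝ, IsIsotropicConstantOf K L := by
  have hn0 : (n : ℝ) ≠ 0 := by positivity
  have hvpos : 0 < volume K := Measure.measure_pos_of_nonempty_interior _ hKi
  have hvfin : volume K ≠ ∞ := hK.measure_lt_top.ne
  set v := (volume K).toReal with hv
  have hv0 : 0 < v := ENNReal.toReal_pos hvpos.ne' hvfin
  set g : EuclideanSpace ℝ (Fin n) := v⁻¹ • ∫ x in K, x with hg
  obtain ⟨B, hBdet, hB⟩ := exists_matrix_setIntegral_inner_sub_sq hK hKi g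
  have hB0 : 0 < |B.det| := abs_pos.2 hBdet.ne_zero
  -- Chosen so that `t B⁻ᵀ` has determinant `±1/v`, making the image of volume one.
  set t : ℝ := (|B.det| / v) ^ (1 / (n : ℝ)) with ht
  have ht0 : 0 < t := by positivity
  have htn : t ^ n = |B.det| / v := by
    rw [ht, ← Real.rpow_natCast, ← Real.rpow_mul (by positivity), one_div_mul_cancel hn0,
      Real.rpow_one]
  set A : Matrix (Fin n) (Fin n) ℝ := t • (B⁻¹).transpose with hA
  have hAdet : |A.det| = v⁻¹ := by
    rw [hA, Matrix.det_smul, Fintype.card_fin, Matrix.det_transpose, Matrix.det_nonsing_inv,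
      Ring.inverse_eq_inv', abs_mul, abs_inv, abs_pow, abs_of_pos ht0, htn]
    field_simp
  have hlin : LinearMap.det (Matrix.toEuclideanLin A) = A.det := LinearMap.det_toLpLin _ _
  have hA0 : LinearMap.det (Matrix.toEuclideanLin A) ≠ 0 := by
    rw [hlin, ← abs_pos, hAdet]
    positivity
  let e : EuclideanSpace ℝ (Fin n) ≃ₗ[ℝ] EuclideanSpace ℝ (Fin n) :=
    LinearMap.equivOfDetNeZero _ hA0
  let T : EuclideanSpace ℝ (Fin n) ≃ᵃ[ℝ] EuclideanSpace ℝ (Fin n) :=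
    (AffineEquiv.constVAdd ℝ _ (-g)).trans e.toAffineEquiv
  have hTlin : (T.linear : EuclideanSpace ℝ (Fin n) →ₗ[ℝ] _) = Matrix.toEuclideanLin A := by
    ext; rfl
  have hT : ∀ x, T x = Matrix.toEuclideanLin A (x - g) := fun x => by
    rw [sub_eq_neg_add]; rfl
  have hdetT : |LinearMap.det (T.linear : EuclideanSpace ℝ (Fin n) →ₗ[ℝ] _)| = v⁻¹ := by
    rw [hTlin, hlin, hAdet]
  have hadj : ∀ x y, inner ℝ (Matrix.toEuclideanLin A x) y =
      inner ℝ x (Matrix.toEuclideanLin (t • B⁻¹) y) := fun x y => by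
    rw [← LinearMap.adjoint_inner_right, ← Matrix.toEuclideanLin_conjTranspose_eq_adjoint]
    simp [hA, Matrix.conjTranspose_eq_transpose_of_trivial]
  have hBA : ∀ y, Matrix.toEuclideanLin B (Matrix.toEuclideanLin (t • B⁻¹) y) = t • y := fun y => by
    apply WithLp.ofLp_injective
    simp [Matrix.mulVec_mulVec, Matrix.mul_nonsing_inv _ hBdet]
  -- The form becomes `v⁻¹ ‖B (t B⁻¹ y)‖² = (t² / v) ‖y‖²`.
  refine ⟨t / √v, T, ?_, ?_, by positivity, fun y => ?_⟩
  · rw [setIntegral_image_affineEquiv T hK.measurableSet]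
    have hid : IntegrableOn (fun x : EuclideanSpace ℝ (Fin n) => x) K :=
      continuous_id.continuousOn.integrableOn_compact hK
    have hsub : ∫ x in K, (x - g) = 0 := by
      rw [integral_sub hid (integrableOn_const hvfin), setIntegral_const, hg, Measure.real, ← hv,
        smul_inv_smul₀ hv0.ne', sub_self]
    have hint : ∫ x in K, LinearMap.toContinuousLinearMap (Matrix.toEuclideanLin A) (x - g) = 0 := by
      have hidg : IntegrableOn (fun x : EuclideanSpace ℝ (Fin n) => x - g) K :=
        hid.sub (integrableOn_const hvfin)
      rw [ContinuousLinearMap.integral_comp_comm _ hidg, hsub, map_zero]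
    simp_rw [hT]
    exact smul_eq_zero_of_right _ hint
  · rw [volume_image_affineEquiv, hdetT, ENNReal.ofReal_inv_of_pos hv0, ENNReal.ofReal_toReal hvfin,
      ENNReal.inv_mul_cancel hvpos.ne' hvfin]
  · rw [setIntegral_image_affineEquiv T hK.measurableSet, hdetT]
    simp_rw [hT, hadj]
    rw [hB, hBA, norm_smul, Real.norm_of_nonneg ht0.le, div_pow, Real.sq_sqrt hv0.le, smul_eq_mul]
    ring

/-! ### The bound by the volume ratio. -/

theorem IsIsotropicConstantOf.le_of_volumeRatio_lt {n : ℕ} (hn : 1 ≤ n)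
    {K : Set (EuclideanSpace ℝ (Fin n))} (hK : IsCompact K) (hKi : (interior K).Nonempty)
    {L C : ℝ} (h : IsIsotropicConstantOf K L)
    (hC : volumeRatio (volumeOneBall n) K < ENNReal.ofReal C) : L ≤ C := by
  obtain ⟨S, hS⟩ := h
  -- The strict inequality yields an actual `T`, so the infimum need not be attained.
  simp only [volumeRatio, iInf_lt_iff] at hC
  obtain ⟨T, hTK, hvol⟩ := hC
  have hn0 : (0 : ℝ) < n := by exact_mod_cast hn
  have hSK := hK.image_affineEquiv S
  have hdet := abs_det_linear_eq_toReal_volume_image (S.symm.trans T) hS.volume_eq_one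
  have h := hS.card_mul_le_setIntegral_norm_sq hn hSK (S.symm.trans T)
  rw [image_symm_trans_image] at hdet
  have hle : ∫ x in S '' K, ‖(S.symm.trans T) x‖ ^ 2 ≤ ∫ _x in S '' K, (n : ℝ) := by
    have hc : Continuous (S.symm.trans T) :=
      (S.symm.trans T).toAffineMap.continuous_of_finiteDimensional
    refine setIntegral_mono_on ((hc.norm.pow 2).continuousOn.integrableOn_compact hSK)
      (integrableOn_const hSK.measure_lt_top.ne) hSK.measurableSet ?_
    rintro _ ⟨x, hx, rfl⟩
    have := volumeOneBall_subset_closedBall_sqrt hn (hTK ⟨x, hx, rfl⟩)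
    rw [mem_closedBall_zero_iff] at this
    rw [AffineEquiv.trans_apply, AffineEquiv.symm_apply_apply]
    exact (Real.le_sqrt (norm_nonneg _) hn0.le).1 this
  rw [setIntegral_const, Measure.real, hS.volume_eq_one, ENNReal.toReal_one, one_smul] at hle
  have hfin : volume (T '' K) ≠ ∞ := (hK.image_affineEquiv T).measure_lt_top.ne
  have hd0 : LinearMap.det (T.linear : EuclideanSpace ℝ (Fin n) →ₗ[ℝ] _) ≠ 0 :=
    (LinearEquiv.isUnit_det' T.linear).ne_zero
  have hpos : volume (T '' K) ≠ 0 := by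
    rw [volume_image_affineEquiv]
    exact mul_ne_zero (by simpa using hd0) (Measure.measure_pos_of_nonempty_interior _ hKi).ne'
  set d := (volume (T '' K)).toReal with hd
  have hdpos : 0 < d := ENNReal.toReal_pos hpos hfin
  rw [volume_volumeOneBall hn, ← ENNReal.ofReal_toReal hfin, ← hd, one_div,
    ← ENNReal.ofReal_inv_of_pos hdpos, ENNReal.ofReal_rpow_of_pos (by positivity)] at hvol
  have hvol' := (ENNReal.ofReal_lt_ofReal_iff_of_nonneg (by positivity)).1 hvol
  rw [Real.inv_rpow hdpos.le] at hvol'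
  have hr : 0 < d ^ (1 / (n : ℝ)) := by positivity
  rw [hdet] at h
  have hsq : (d ^ (1 / (n : ℝ)) * L) ^ 2 ≤ 1 := by
    have := h.trans hle
    nlinarith
  have hone : d ^ (1 / (n : ℝ)) * L ≤ 1 := by
    nlinarith [sq_nonneg (d ^ (1 / (n : ℝ)) * L - 1)]
  calc L ≤ (d ^ (1 / (n : ℝ)))⁻¹ := by rwa [← one_div, le_div_iff₀' hr]
    _ ≤ C := hvol'.le

theorem mainTheorem2 (c : ℝ) :
    ∃ c' : ℝ, ∀ (n : ℕ), 1 ≤ n →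
      ∀ K : ConvexBody (EuclideanSpace ℝ (Fin n)),
        (interior (K : Set (EuclideanSpace ℝ (Fin n)))).Nonempty →
        volumeRatio (volumeOneBall n) (K : Set (EuclideanSpace ℝ (Fin n))) ≤ ENNReal.ofReal c →
        (∃! L : ℝ, IsIsotropicConstantOf (K : Set (EuclideanSpace ℝ (Fin n))) L) ∧
          ∀ L : ℝ, IsIsotropicConstantOf (K : Set (EuclideanSpace ℝ (Fin n))) L → L ≤ c' := by
  -- The `+ 1` makes the bound strict; the absolute value keeps it positive when `c` is negative.
  refine ⟨|c| + 1, fun n hn K hKi hvr => ⟨?_, fun L hL => ?_⟩⟩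
  · obtain ⟨L, S, hS⟩ := exists_isIsotropicConstantOf hn K.isCompact hKi
    refine ⟨L, ⟨S, hS⟩, ?_⟩
    rintro M ⟨T, hT⟩
    exact le_antisymm (hT.le_of_image_affineEquiv hn K.isCompact hS)
      (hS.le_of_image_affineEquiv hn K.isCompact hT)
  · refine hL.le_of_volumeRatio_lt hn K.isCompact hKi (hvr.trans_lt ?_)
    rw [ENNReal.ofReal_lt_ofReal_iff (by positivity)]
    linarith [le_abs_self c]
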